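/- Let $k,r$ be integers with $2\le k\le r$. A *$k$-graph* is a finite $k$-uniform hypergraph. For a $k$-graph $H$, let $\mathrm{ex}(n,H)$ be the maximum number of edges of a $k$-graph on $n$ vertices containing no (not necessarily induced) copy of $H$, and let $\pi(H)=\lim_{n\to\infty}\mathrm{ex}(n,H)/\binom nk$ be its Turán density. For a $k$-graph $G=(V,E)$ let $$b(G)=k!\,\max\Big\{\sum_{e\in E}\prod_{v\in e}x_v \;:\; x_v\ge 0\ (v\in V),\ \sum_{v\in V}x_v=1\Big\}$$ be its blowup density, and let $K_r^{(k)}$ be the complete $k$-graph on $r$ vertices. A *partial $k$-graph* is a finite simplicial complex all of whose faces have at most $k$ vertices. Its *extension* is the $k$-graph obtained by enlarging every maximal face $e$ to a $k$-set by adding $k-|e|$ new vertices, where different maximal faces do not share new vertices. Let $F$ be the partial $k$-graph on the vertex set $[r+1]=\{1,\dots,r+1\}$ generated by $[k]$ and all the $2$-subsets of $[r+1]$ (that is, its nonempty faces are the nonempty subsets of these sets), and let $\tilde F$ be its extension. Then the limit defining $\pi(\tilde F)$ exists and $$\pi(\tilde F)=b\big(K_r^{(k)}\big).$$ -/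

import Mathlib

open Filter Topology

noncomputable section

/-- A `k`-graph (`k`-uniform hypergraph) with vertex set `V`: a finite set of edges, each of which
is a `k`-element subset of `V`. -/
structure KGraph (k : ℕ) (V : Type*) where
  /-- the edges -/
  edges : Finset (Finset V)
  /-- every edge has exactly `k` vertices -/
  card_eq : ∀ e ∈ edges, e.card = k

namespace KGraph

variable {k : ℕ} {V W : Type*}

/-- The complete `k`-graph `K_r^{(k)}` on `r` vertices. -/
def complete (k r : ℕ) : KGraph k (Fin r) where
  edges := Finset.univ.powersetCard k
  card_eq _ he := (Finset.mem_powersetCard.mp he).2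

/-- `G` contains a (not necessarily induced) copy of `H`. -/
def Contains (G : KGraph k V) (H : KGraph k W) : Prop :=
  ∃ f : W ↪ V, ∀ e ∈ H.edges, e.map f ∈ G.edges

/-- The Turán number `ex(n, H)`: the maximum number of edges of a `k`-graph on `n` vertices that
contains no copy of `H`. -/
def extremalNumber (n : ℕ) (H : KGraph k W) : ℕ :=
  sSup {m | ∃ G : KGraph k (Fin n), ¬ G.Contains H ∧ G.edges.card = m}

/-- The ratio `ex(n, H) / (n choose k)`. -/
def extremalRatio (H : KGraph k W) (n : ℕ) : ℝ :=
  (extremalNumber n H : ℝ) / (n.choose k : ℝ)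

/-- The Turán density `π(H)`, the limit of `ex(n, H) / (n choose k)` as `n` tends to infinity. -/
def turanDensity (H : KGraph k W) : ℝ :=
  limUnder atTop (extremalRatio H)

/-- The hypergraph Lagrangian `L(G)`: the maximum of `∑_{e ∈ E(G)} ∏_{v ∈ e} x_v` over all
nonnegative weights `x` on the vertices of total weight `1`. -/
def lagrangian [Fintype V] (G : KGraph k V) : ℝ :=
  sSup ((fun x : V → ℝ => ∑ e ∈ G.edges, ∏ v ∈ e, x v) '' stdSimplex ℝ V)

/-- The blowup density `b(G) = k! L(G)`. -/
def blowupDensity [Fintype V] (G : KGraph k V) : ℝ :=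
  (k.factorial : ℝ) * G.lagrangian

end KGraph

/-- A partial `k`-graph with vertex set `V`: an abstract simplicial complex whose faces (the
partial edges) have at most `k` vertices. The empty face is not recorded. -/
structure PartialKGraph (k : ℕ) (V : Type*) extends AbstractSimplicialComplex V where
  /-- every partial edge has at most `k` vertices -/
  card_le : ∀ e ∈ faces, e.card ≤ k

namespace PartialKGraph

variable {k : ℕ} {V : Type*}

/-- The partial `k`-graph on `V` generated by a set `S` of subsets of `V` of size at most `k`: its
partial edges are the singletons and the nonempty subsets of the members of `S`. -/
def generatedBy (hk : 1 ≤ k) (S : Set (Finset V)) (hS : ∀ s ∈ S, s.card ≤ k) :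
    PartialKGraph k V where
  faces := {e | e.Nonempty ∧ ((∃ v, e = {v}) ∨ ∃ s ∈ S, e ⊆ s)}
  isRelLowerSet_faces := by
    rintro e ⟨he, h⟩
    refine ⟨he, fun t hte ht => ⟨ht, ?_⟩⟩
    rcases h with ⟨v, rfl⟩ | ⟨s, hs, hes⟩
    · exact Or.inl ⟨v, (Finset.Nonempty.subset_singleton_iff ht).mp hte⟩
    · exact Or.inr ⟨s, hs, hte.trans hes⟩
  singleton_mem v := ⟨Finset.singleton_nonempty v, Or.inl ⟨v, rfl⟩⟩
  card_le := by
    rintro e ⟨-, ⟨v, rfl⟩ | ⟨s, hs, hes⟩⟩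
    · simpa using hk
    · exact (Finset.card_le_card hes).trans (hS s hs)

/-- The maximal partial edges of `F`. -/
abbrev MaximalEdge (F : PartialKGraph k V) : Type _ :=
  {e : Finset V // Maximal (fun s => s ∈ F.faces) e}

/-- The vertices of the extension of `F`: the vertices of `F` together with, for every maximal
partial edge `e` of `F`, its own `k - |e|` extra vertices. -/
abbrev ExtensionVertex (F : PartialKGraph k V) : Type _ :=
  V ⊕ (Σ e : F.MaximalEdge, Fin (k - e.1.card))

/-- The edge of the extension that a maximal partial edge `e` is enlarged to: the vertices of `e`
and the extra vertices of `e`. -/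
def extendedEdge (F : PartialKGraph k V) (e : F.MaximalEdge) : Finset F.ExtensionVertex :=
  e.1.disjSum (Finset.univ.map
    (Function.Embedding.sigmaMk (β := fun e : F.MaximalEdge => Fin (k - e.1.card)) e))

open Classical in
/-- The extension of a partial `k`-graph `F`: the `k`-graph obtained by enlarging every maximal
partial edge of `F` to a `k`-edge by extra vertices, where different edges do not share extra
vertices. -/
def extension [Fintype V] (F : PartialKGraph k V) : KGraph k F.ExtensionVertex where
  edges := Finset.univ.image F.extendedEdge
  card_eq := by
    intro e he
    obtain ⟨e, -, rfl⟩ := Finset.mem_image.mp he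
    have h := F.card_le e.1 e.2.1
    simp only [extendedEdge, Finset.card_disjSum, Finset.card_map, Finset.card_univ,
      Fintype.card_fin]
    omega

/-- The partial `k`-graph on `r + 1` vertices generated by the set of the first `k` vertices and
all the `2`-subsets of the vertex set. -/
def cliqueWithEdge (k r : ℕ) (hk : 2 ≤ k) : PartialKGraph k (Fin (r + 1)) :=
  generatedBy (one_le_two.trans hk)
    (insert (Finset.univ.filter fun i : Fin (r + 1) => (i : ℕ) < k)
      {e : Finset (Fin (r + 1)) | e.card = 2})
    (by
      rintro s (rfl | hs)
      · rw [Fin.card_filter_val_lt]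
        exact min_le_right _ _
      · exact (show s.card = 2 from hs).trans_le hk)

end PartialKGraph

end

/-! Both bounds compare edge counts with the polynomial `weight` on the simplex, whose maximum is
the Lagrangian.

Lower bound: take a complete `r`-partite `k`-graph with parts of size about `x i * n`, where `x` is
an optimal weight for `complete k r` (`exists_partite`). Two of the `r + 1` original vertices of an
embedded extension would share a part, although every such pair lies in an edge
(`not_contains_of_coloring`).

Upper bound: deleting `O(n ^ (k - 1))` edges makes every covered pair robust, that is, it lies in an
edge avoiding any given bounded set disjoint from the pair (`exists_robust_subgraph`). If `r + 1`
pairwise covered vertices then contained an edge, that edge would serve as `[k]` and the remaining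
edges of the extension could be chosen greedily (`contains_extension_of_robust`). So there is no
such set. Motzkin–Straus symmetrization concentrates any weight on a pairwise covered support
without decreasing the polynomial. A support of more than `r` vertices contains no edge and gives
value zero; a smaller one embeds in `complete k r` (`weight_le_lagrangian_complete`). The uniform
weight turns this into an edge bound. -/

noncomputable section

namespace KGraph

variable {k : ℕ} {V W : Type*}

/-! ### Making covered pairs robust by deleting edges -/

/-- The ordered pairs of distinct vertices covered by a member of `E`. -/
def coveredPairs [Fintype V] [DecidableEq V] (E : Finset (Finset V)) : Finset (V × V) :=
  Finset.univ.filter fun p => p.1 ≠ p.2 ∧ ∃ e ∈ E, p.1 ∈ e ∧ p.2 ∈ e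

theorem mem_coveredPairs [Fintype V] [DecidableEq V] {E : Finset (Finset V)} {p : V × V} :
    p ∈ coveredPairs E ↔ p.1 ≠ p.2 ∧ ∃ e ∈ E, p.1 ∈ e ∧ p.2 ∈ e := by
  simp [coveredPairs]

/-- The number of `k`-sets containing a fixed set `t`. -/
theorem card_superset_le [Fintype V] [DecidableEq V] (E : Finset (Finset V))
    (hE : ∀ e ∈ E, e.card = k) (t : Finset V) (h : ∀ e ∈ E, t ⊆ e) :
    E.card ≤ Fintype.card V ^ (k - t.card) := by
  calc E.card ≤ (Finset.univ.powersetCard (k - t.card) : Finset (Finset V)).card := by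
        refine Finset.card_le_card_of_injOn (fun e => e \ t) ?_ ?_
        · intro e he
          refine Finset.mem_coe.2 (Finset.mem_powersetCard.2 ⟨Finset.subset_univ _, ?_⟩)
          rw [Finset.card_sdiff_of_subset (h e he), hE e he]
        · intro e he e' he' hee
          rw [← Finset.sdiff_union_of_subset (h e he), ← Finset.sdiff_union_of_subset (h e' he')]
          exact congrArg (· ∪ t) hee
    _ = (Fintype.card V).choose (k - t.card) := by simp
    _ ≤ _ := Nat.choose_le_pow _ _

/-- A set of edges contains a subset, obtained by deleting few edges, in which every covered pair
of vertices lies in many edges. -/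
theorem exists_subset_codegree_ge [Fintype V] [DecidableEq V] (E : Finset (Finset V)) (M : ℕ) :
    ∃ E' ⊆ E, E.card ≤ E'.card + M * Fintype.card V ^ 2 ∧
      ∀ u v, (u, v) ∈ coveredPairs E' → M ≤ (E'.filter fun e => u ∈ e ∧ v ∈ e).card := by
  -- A maximizer of this score replaces iterated deletion: removing all edges through a pair of
  -- codegree below `M` costs fewer than `M` edges and uncovers that pair, so it would raise the
  -- score. Integers avoid truncated subtraction.
  obtain ⟨E', hE', hmax⟩ := Finset.exists_max_image E.powerset
    (fun A => (A.card : ℤ) - M * (coveredPairs A).card) ⟨E, Finset.mem_powerset_self E⟩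
  rw [Finset.mem_powerset] at hE'
  refine ⟨E', hE', ?_, ?_⟩
  · have h1 := hmax E (Finset.mem_powerset_self E)
    have h2 : (coveredPairs E).card ≤ Fintype.card V ^ 2 := by
      refine (Finset.card_le_univ _).trans ?_
      rw [Fintype.card_prod, sq]
    have h3 := Nat.mul_le_mul_left M h2
    zify at h3 ⊢
    have h4 : (0 : ℤ) ≤ M * (coveredPairs E').card := by positivity
    linarith
  · intro u v huv
    set D := E'.filter fun e => ¬ (u ∈ e ∧ v ∈ e) with hD
    have h1 := hmax D (Finset.mem_powerset.2 ((Finset.filter_subset _ _).trans hE'))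
    have h2 : coveredPairs D ⊂ coveredPairs E' := by
      refine (Finset.ssubset_iff_of_subset ?_).2 ⟨(u, v), huv, ?_⟩
      · intro p hp
        rw [mem_coveredPairs] at hp ⊢
        obtain ⟨hne, e, he, h⟩ := hp
        exact ⟨hne, e, (Finset.mem_filter.1 he).1, h⟩
      · rw [mem_coveredPairs]
        rintro ⟨-, e, he, h⟩
        exact (Finset.mem_filter.1 he).2 h
    have h3 : (coveredPairs D).card + 1 ≤ (coveredPairs E').card := Finset.card_lt_card h2
    have h4 : (E'.filter fun e => u ∈ e ∧ v ∈ e).card + D.card = E'.card :=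
      Finset.card_filter_add_card_filter_not _
    have h5 := Nat.mul_le_mul_left M h3
    zify at h5 h4 ⊢
    linarith

/-- By deleting `O(n ^ (k - 1))` edges one obtains a `k`-graph in which every covered pair of
vertices lies in an edge that avoids any prescribed set of bounded size. -/
theorem exists_robust_subgraph [Fintype V] [DecidableEq V] (hk : 2 ≤ k) (G : KGraph k V) (s : ℕ) :
    ∃ G' : KGraph k V, G'.edges ⊆ G.edges ∧
      G.edges.card ≤ G'.edges.card + (s + 1) * Fintype.card V ^ (k - 1) ∧
      ∀ u v, u ≠ v → (∃ e ∈ G'.edges, u ∈ e ∧ v ∈ e) → ∀ S : Finset V, S.card ≤ s →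
        u ∉ S → v ∉ S → ∃ e ∈ G'.edges, u ∈ e ∧ v ∈ e ∧ Disjoint e S := by
  -- For `k = 2` the edge is the pair itself and nothing is deleted; the exponent `k - 3` below
  -- would be truncated.
  obtain rfl | hk3 := hk.eq_or_lt
  · refine ⟨G, subset_rfl, Nat.le_add_right _ _, ?_⟩
    rintro u v huv ⟨e, he, hu, hv⟩ S - hus hvs
    refine ⟨e, he, hu, hv, ?_⟩
    have : {u, v} = e := Finset.eq_of_subset_of_card_le
      (by simp [Finset.insert_subset_iff, hu, hv]) (by rw [G.card_eq e he, Finset.card_pair huv])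
    simp [← this, hus, hvs]
  -- For each `w ∈ S`, at most `n ^ (k - 3)` edges contain `u`, `v` and `w`, so codegree `(s + 1) *
  -- n ^ (k - 3)` leaves an edge missing `S`.
  obtain ⟨E', hE', hcard, hdeg⟩ :=
    exists_subset_codegree_ge G.edges ((s + 1) * Fintype.card V ^ (k - 3))
  refine ⟨⟨E', fun e he => G.card_eq e (hE' he)⟩, hE', ?_, ?_⟩
  · have : k - 1 = k - 3 + 2 := by omega
    rwa [this, pow_add, ← mul_assoc]
  · rintro u v huv hcov S hS hus hvs
    by_contra! hno
    have h1 := hdeg u v (mem_coveredPairs.2 ⟨huv, hcov⟩)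
    have h2 : (E'.filter fun e => u ∈ e ∧ v ∈ e) ⊆
        S.biUnion fun w => E'.filter fun e => {u, v, w} ⊆ e := by
      intro e he
      obtain ⟨he, hu, hv⟩ := Finset.mem_filter.1 he
      obtain ⟨w, hwe, hwS⟩ := Finset.not_disjoint_iff.1 (hno e he hu hv)
      simp only [Finset.mem_biUnion, Finset.mem_filter, Finset.insert_subset_iff,
        Finset.singleton_subset_iff]
      exact ⟨w, hwS, he, hu, hv, hwe⟩
    have h3 := (Finset.card_le_card h2).trans (Finset.card_biUnion_le_card_mul S _
      (Fintype.card V ^ (k - 3)) ?_)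
    · have h4 : 0 < Fintype.card V ^ (k - 3) := pow_pos (Fintype.card_pos_iff.2 ⟨u⟩) _
      have := h1.trans (h3.trans (Nat.mul_le_mul_right _ hS))
      nlinarith
    · intro w hw
      have h3 : ({u, v, w} : Finset V).card = 3 := Finset.card_eq_three.2
        ⟨u, v, w, huv, fun h => hus (h ▸ hw), fun h => hvs (h ▸ hw), rfl⟩
      rw [← h3]
      exact card_superset_le _ (fun e he => G.card_eq e (hE' (Finset.mem_filter.1 he).1)) _
        (fun e he => (Finset.mem_filter.1 he).2)

/-! ### The Lagrangian and Motzkin–Straus symmetrization -/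

/-- The edge polynomial of a `k`-graph. -/
def weight (G : KGraph k V) (x : V → ℝ) : ℝ := ∑ e ∈ G.edges, ∏ v ∈ e, x v

theorem weight_nonneg (G : KGraph k V) {x : V → ℝ} (hx : ∀ v, 0 ≤ x v) : 0 ≤ G.weight x :=
  Finset.sum_nonneg fun _ _ => Finset.prod_nonneg fun v _ => hx v

theorem isCompact_weight_image [Fintype V] (G : KGraph k V) :
    IsCompact (G.weight '' stdSimplex ℝ V) := by
  refine (isCompact_stdSimplex ℝ V).image ?_
  unfold weight
  fun_prop

theorem weight_le_lagrangian [Fintype V] (G : KGraph k V) {x : V → ℝ} (hx : x ∈ stdSimplex ℝ V) :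
    G.weight x ≤ G.lagrangian :=
  le_csSup G.isCompact_weight_image.bddAbove ⟨x, hx, rfl⟩

theorem exists_weight_eq_lagrangian [Fintype V] [Nonempty V] (G : KGraph k V) :
    ∃ x ∈ stdSimplex ℝ V, G.weight x = G.lagrangian := by
  classical
  exact G.isCompact_weight_image.sSup_mem
    (Set.Nonempty.image _ ⟨_, single_mem_stdSimplex ℝ (Classical.arbitrary V)⟩)

/-- Moving all the weight of `v` to `u`. -/
def shift [DecidableEq V] (x : V → ℝ) (u v : V) : V → ℝ :=
  Function.update (Function.update x u (x u + x v)) v 0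

theorem shift_left [DecidableEq V] (x : V → ℝ) {u v : V} (h : u ≠ v) :
    shift x u v u = x u + x v := by simp [shift, h]

theorem shift_right [DecidableEq V] (x : V → ℝ) (u v : V) : shift x u v v = 0 := by simp [shift]

theorem shift_of_ne [DecidableEq V] (x : V → ℝ) {u v w : V} (hu : w ≠ u) (hv : w ≠ v) :
    shift x u v w = x w := by simp [shift, hu, hv]

theorem shift_mem_stdSimplex [Fintype V] [DecidableEq V] {x : V → ℝ} (hx : x ∈ stdSimplex ℝ V)
    {u v : V} (h : u ≠ v) : shift x u v ∈ stdSimplex ℝ V := by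
  refine ⟨fun w => ?_, ?_⟩
  · by_cases hv : w = v
    · rw [hv, shift_right]
    by_cases hu : w = u
    · rw [hu, shift_left x h]
      exact add_nonneg (hx.1 u) (hx.1 v)
    rw [shift_of_ne x hu hv]
    exact hx.1 w
  · rw [← hx.2, ← Finset.add_sum_erase _ _ (Finset.mem_univ v),
      ← Finset.add_sum_erase _ _ (Finset.mem_erase.2 ⟨h, Finset.mem_univ u⟩),
      ← Finset.add_sum_erase _ x (Finset.mem_univ v),
      ← Finset.add_sum_erase _ x (Finset.mem_erase.2 ⟨h, Finset.mem_univ u⟩),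
      shift_right, shift_left x h, Finset.sum_congr rfl fun w hw => ?_]
    · ring
    · simp only [Finset.mem_erase] at hw
      exact shift_of_ne x hw.1 hw.2.1

theorem prod_shift_of_notMem [DecidableEq V] (x : V → ℝ) {u v : V} {e : Finset V} (hu : u ∉ e)
    (hv : v ∉ e) : ∏ w ∈ e, shift x u v w = ∏ w ∈ e, x w :=
  Finset.prod_congr rfl fun _ hw =>
    shift_of_ne x (fun h => hu (h ▸ hw)) (fun h => hv (h ▸ hw))

/-- The factor `x u` clears the denominator, so no positivity of `x u` is needed. -/
theorem prod_shift_of_left_mem [DecidableEq V] (x : V → ℝ) {u v : V} {e : Finset V} (hu : u ∈ e)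
    (hv : v ∉ e) : x u * ∏ w ∈ e, shift x u v w = (x u + x v) * ∏ w ∈ e, x w := by
  have huv : u ≠ v := fun h => hv (h ▸ hu)
  rw [← Finset.mul_prod_erase e _ hu, ← Finset.mul_prod_erase e x hu, shift_left x huv,
    prod_shift_of_notMem x (Finset.notMem_erase u e) fun h => hv (Finset.mem_of_mem_erase h)]
  ring

theorem prod_shift_of_right_mem [DecidableEq V] (x : V → ℝ) {u v : V} {e : Finset V}
    (hv : v ∈ e) : ∏ w ∈ e, shift x u v w = 0 :=
  Finset.prod_eq_zero hv (shift_right x u v)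

/-- The edge polynomial is affine in the direction of a pair of vertices that is not covered. -/
theorem weight_shift [DecidableEq V] (G : KGraph k V) (x : V → ℝ) {u v : V}
    (h : ∀ e ∈ G.edges, u ∈ e → v ∉ e) :
    x u * G.weight (shift x u v) + x v * G.weight (shift x v u) = (x u + x v) * G.weight x := by
  simp only [weight, Finset.mul_sum, ← Finset.sum_add_distrib]
  refine Finset.sum_congr rfl fun e he => ?_
  by_cases hu : u ∈ e
  · rw [prod_shift_of_left_mem x hu (h e he hu), prod_shift_of_right_mem x hu]
    ring
  by_cases hv : v ∈ e
  · rw [prod_shift_of_left_mem x hv hu, prod_shift_of_right_mem x hv]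
    ring
  rw [prod_shift_of_notMem x hu hv, prod_shift_of_notMem x hv hu]
  ring

/-- Every weight can be replaced by one of at least the same value whose support is pairwise
covered by edges. -/
theorem exists_weight_le_covered_support [Fintype V] [DecidableEq V] (G : KGraph k V) (x : V → ℝ)
    (hx : x ∈ stdSimplex ℝ V) :
    ∃ y ∈ stdSimplex ℝ V, G.weight x ≤ G.weight y ∧
      ∀ u v, u ≠ v → y u ≠ 0 → y v ≠ 0 → ∃ e ∈ G.edges, u ∈ e ∧ v ∈ e := by
  induction hm : (Finset.univ.filter fun v => x v ≠ 0).card using Nat.strong_induction_on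
    generalizing x with
  | _ m ih =>
  by_cases hcov : ∀ u v, u ≠ v → x u ≠ 0 → x v ≠ 0 → ∃ e ∈ G.edges, u ∈ e ∧ v ∈ e
  · exact ⟨x, hx, le_rfl, hcov⟩
  push Not at hcov
  obtain ⟨u, v, huv, hu, hv, hno⟩ := hcov
  have key : ∀ a b, a ≠ b → x a ≠ 0 → x b ≠ 0 → G.weight x ≤ G.weight (shift x a b) →
      ∃ y ∈ stdSimplex ℝ V, G.weight x ≤ G.weight y ∧
        ∀ u v, u ≠ v → y u ≠ 0 → y v ≠ 0 → ∃ e ∈ G.edges, u ∈ e ∧ v ∈ e := by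
    intro a b hab ha hb hle
    have hlt : (Finset.univ.filter fun v => shift x a b v ≠ 0).card < m := by
      rw [← hm]
      refine Finset.card_lt_card ((Finset.ssubset_iff_of_subset ?_).2 ⟨b, ?_, ?_⟩)
      · intro w hw
        simp only [Finset.mem_filter, Finset.mem_univ, true_and] at hw ⊢
        by_cases hwb : w = b
        · exact hwb ▸ hb
        by_cases hwa : w = a
        · exact hwa ▸ ha
        rwa [shift_of_ne x hwa hwb] at hw
      · simpa using hb
      · simp [shift_right]
    obtain ⟨y, hy, hxy, h⟩ := ih _ hlt _ (shift_mem_stdSimplex hx hab) rfl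
    exact ⟨y, hy, hle.trans hxy, h⟩
  have hpu : 0 < x u := lt_of_le_of_ne (hx.1 u) hu.symm
  have hpv : 0 < x v := lt_of_le_of_ne (hx.1 v) hv.symm
  have hid := G.weight_shift x hno
  by_cases h1 : G.weight x ≤ G.weight (shift x u v)
  · exact key u v huv hu hv h1
  · refine key v u huv.symm hv hu ?_
    push Not at h1
    -- `weight x` is a weighted average of its two shifts with positive coefficients, so both cannot
    -- be smaller.
    by_contra! h2
    nlinarith

/-- If no `r + 1` pairwise covered vertices of `G` contain an edge, then the edge polynomial of `G`
is bounded by the Lagrangian of the complete `k`-graph on `r` vertices. -/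
theorem weight_le_lagrangian_complete [Fintype V] [DecidableEq V] {r : ℕ} (hk : 1 ≤ k)
    (hr : k ≤ r) (G : KGraph k V)
    (hG : ∀ T : Finset V, T.card = r + 1 →
      (∀ u ∈ T, ∀ v ∈ T, u ≠ v → ∃ e ∈ G.edges, u ∈ e ∧ v ∈ e) → ∀ e ∈ G.edges, ¬ e ⊆ T)
    (x : V → ℝ) (hx : x ∈ stdSimplex ℝ V) : G.weight x ≤ (complete k r).lagrangian := by
  obtain ⟨y, hy, hxy, hcov⟩ := G.exists_weight_le_covered_support x hx
  refine hxy.trans ?_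
  set S := Finset.univ.filter fun v => y v ≠ 0 with hS
  have hmemS : ∀ v, v ∈ S ↔ y v ≠ 0 := by simp [hS]
  have hzero : ∀ e : Finset V, ¬ e ⊆ S → ∏ v ∈ e, y v = 0 := by
    intro e he
    obtain ⟨v, hve, hvS⟩ := Finset.not_subset.1 he
    exact Finset.prod_eq_zero hve (not_not.1 (mt (hmemS v).2 hvS))
  by_cases hcard : S.card ≤ r
  · obtain ⟨f⟩ : Nonempty (S ↪ Fin r) :=
      Function.Embedding.nonempty_of_card_le (by simpa using hcard)
    -- The pushforward of `y` along `f`; by injectivity each sum has at most one nonzero term.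
    set z : Fin r → ℝ := fun i => ∑ v : S, if f v = i then y v else 0 with hz
    have hzf : ∀ v : S, z (f v) = y v := by
      intro v
      simp [hz]
    have hzs : z ∈ stdSimplex ℝ (Fin r) := by
      refine ⟨fun i => Finset.sum_nonneg fun v _ => ?_, ?_⟩
      · split_ifs
        exacts [hy.1 _, le_rfl]
      · simp only [hz]
        rw [Finset.sum_comm]
        simp only [Finset.sum_ite_eq, Finset.mem_univ, if_true]
        rw [← hy.2, Finset.sum_coe_sort S y]
        refine Finset.sum_subset (Finset.subset_univ _) fun v _ hv => ?_
        exact not_not.1 (mt (hmemS v).2 hv)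
    refine le_trans ?_ (weight_le_lagrangian (complete k r) hzs)
    have h1 : G.weight y = ∑ e ∈ G.edges.filter (· ⊆ S), ∏ v ∈ e, y v := by
      rw [weight, Finset.sum_filter_of_ne]
      intro e _ he
      by_contra h
      exact he (hzero e h)
    have hsub : ∀ e : Finset V, e ⊆ S → (e.subtype (· ∈ S)).map (.subtype _) = e := by
      intro e he
      rw [Finset.subtype_map, Finset.filter_true_of_mem he]
    rw [h1, weight]
    have h2 : ∀ e ∈ G.edges.filter (· ⊆ S),
        ∏ v ∈ e, y v = ∏ i ∈ (e.subtype (· ∈ S)).map f, z i := by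
      intro e he
      rw [Finset.prod_map]
      simp only [hzf]
      conv_lhs => rw [← hsub e (Finset.mem_filter.1 he).2, Finset.prod_map]
      rfl
    -- Distinct edges inside `S` have distinct images, so the sum becomes a partial sum of the
    -- polynomial of `complete k r`.
    rw [Finset.sum_congr rfl h2,
      ← Finset.sum_image (f := fun a : Finset (Fin r) => ∏ i ∈ a, z i)
        (g := fun e : Finset V => (e.subtype (· ∈ S)).map f)]
    · refine Finset.sum_le_sum_of_subset_of_nonneg ?_
        fun _ _ _ => Finset.prod_nonneg fun i _ => hzs.1 i
      intro a ha
      obtain ⟨e, he, rfl⟩ := Finset.mem_image.1 ha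
      obtain ⟨he, heS⟩ := Finset.mem_filter.1 he
      refine Finset.mem_powersetCard.2 ⟨Finset.subset_univ _, ?_⟩
      rw [Finset.card_map, ← G.card_eq e he]
      conv_rhs => rw [← hsub e heS, Finset.card_map]
    · intro e he e' he' hee
      rw [← hsub e (Finset.mem_filter.1 he).2, ← hsub e' (Finset.mem_filter.1 he').2,
        Finset.map_injective f hee]
  · have hr0 : Nonempty (Fin r) := ⟨⟨0, by omega⟩⟩
    obtain ⟨z, hz, hzl⟩ := exists_weight_eq_lagrangian (complete k r)
    -- An edge inside the support would extend to `r + 1` pairwise covered vertices, which `hG`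
    -- forbids.
    have h0 : G.weight y = 0 := by
      refine Finset.sum_eq_zero fun e he => hzero e fun heS => ?_
      obtain ⟨T, heT, hTS, hT⟩ := Finset.exists_subsuperset_card_eq (n := r + 1) heS
        (by rw [G.card_eq e he]; omega) (by omega)
      exact hG T hT (fun u hu v hv huv => hcov u v huv ((hmemS u).1 (hTS hu))
        ((hmemS v).1 (hTS hv))) e he heT
    rw [h0, ← hzl]
    exact weight_nonneg _ hz.1

/-- A bound on the edge polynomial bounds the number of edges. -/
theorem card_edges_le_of_weight_le [Fintype V] (G : KGraph k V) (L : ℝ) (hL : 0 ≤ L)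
    (hk : 1 ≤ k)
    (h : ∀ x ∈ stdSimplex ℝ V, G.weight x ≤ L) :
    (G.edges.card : ℝ) ≤ L * (Fintype.card V : ℝ) ^ k := by
  rcases isEmpty_or_nonempty V with hV | hV
  · have : G.edges = ∅ := by
      refine Finset.eq_empty_of_forall_notMem fun e he => ?_
      have := G.card_eq e he
      rw [Finset.eq_empty_of_isEmpty e, Finset.card_empty] at this
      omega
    rw [this]
    simp only [Finset.card_empty, Nat.cast_zero]
    positivity
  have hn : (0 : ℝ) < Fintype.card V := by exact_mod_cast Fintype.card_pos
  have h1 := h (fun _ => (Fintype.card V : ℝ)⁻¹)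
    ⟨fun _ => by positivity, by simp [hn.ne']⟩
  have h2 : G.weight (fun _ => (Fintype.card V : ℝ)⁻¹) =
      G.edges.card * ((Fintype.card V : ℝ) ^ k)⁻¹ := by
    rw [weight, Finset.sum_congr rfl fun e he => by
      rw [Finset.prod_const, G.card_eq e he, inv_pow], Finset.sum_const, nsmul_eq_mul]
  rwa [h2, ← div_eq_mul_inv, div_le_iff₀ (by positivity)] at h1

end KGraph
end

noncomputable section

/-! ### Embedding the extension, and the upper bound -/

namespace PartialKGraph

variable {k r : ℕ} {V W : Type*}

/-- A `k`-graph contains the extension of `F` as soon as the vertices of `F` can be embedded in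
such a way that the image of every maximal partial edge lies in an edge that avoids any given
small set. -/
theorem contains_extension_of_robust [Fintype V] [DecidableEq W] (F : PartialKGraph k V)
    (G : KGraph k W) (φ : V ↪ W) (s : ℕ)
    (hs : Fintype.card V + Nat.card F.MaximalEdge * k ≤ s)
    (h : ∀ m : F.MaximalEdge, ∀ S : Finset W, S.card ≤ s → Disjoint (m.1.map φ) S →
      ∃ e ∈ G.edges, m.1.map φ ⊆ e ∧ Disjoint (e \ m.1.map φ) S) :
    G.Contains F.extension := by
  classical
  have hfin : Fintype F.MaximalEdge := Fintype.ofFinite _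
  rw [Nat.card_eq_fintype_card] at hs
  have greedy : ∀ A : Finset F.MaximalEdge, ∃ E : F.MaximalEdge → Finset W,
      (∀ m ∈ A, E m ∈ G.edges ∧ m.1.map φ ⊆ E m ∧
        Disjoint (E m \ m.1.map φ) (Finset.univ.map φ)) ∧
      ∀ m ∈ A, ∀ m' ∈ A, m ≠ m' → Disjoint (E m \ m.1.map φ) (E m' \ m'.1.map φ) := by
    intro A
    induction A using Finset.induction_on with
    | empty => exact ⟨fun _ => ∅, by simp, by simp⟩
    | insert a A ha ih =>
      obtain ⟨E, hE, hdisj⟩ := ih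
      set U := A.biUnion fun m => E m \ m.1.map φ with hU
      have hUcard : U.card ≤ A.card * k := Finset.card_biUnion_le_card_mul _ _ _ fun m hm =>
        (Finset.card_le_card Finset.sdiff_subset).trans (G.card_eq _ (hE m hm).1).le
      have hUφ : Disjoint U (Finset.univ.map φ) :=
        (Finset.disjoint_biUnion_left _ _ _).2 fun m hm => (hE m hm).2.2
      have hsub : a.1.map φ ⊆ Finset.univ.map φ := Finset.map_subset_map.2 (Finset.subset_univ _)
      -- The new edge must avoid the images of the other vertices of `F` and all extra vertices used
      -- so far; `hs` bounds their number by `s`.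
      obtain ⟨e, he, hae, hed⟩ := h a ((Finset.univ.map φ \ a.1.map φ) ∪ U) (by
        refine (Finset.card_union_le _ _).trans (le_trans (add_le_add ?_ (hUcard.trans
          (Nat.mul_le_mul_right k (Finset.card_le_univ A)))) hs)
        exact (Finset.card_le_card Finset.sdiff_subset).trans (by simp)) (by
        rw [Finset.disjoint_union_right]
        exact ⟨Finset.disjoint_sdiff, (hUφ.mono_right hsub).symm⟩)
      rw [Finset.disjoint_union_right] at hed
      have heU : ∀ m ∈ A, Disjoint (e \ a.1.map φ) (E m \ m.1.map φ) := fun m hm =>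
        (Finset.disjoint_biUnion_right _ _ _).1 hed.2 m hm
      have hne : ∀ m ∈ A, m ≠ a := fun m hm hma => ha (hma ▸ hm)
      refine ⟨Function.update E a e, ?_, ?_⟩
      · intro m hm
        rcases Finset.mem_insert.1 hm with rfl | hm
        · rw [Function.update_self]
          refine ⟨he, hae, ?_⟩
          rw [← Finset.sdiff_union_of_subset hsub, Finset.disjoint_union_right]
          exact ⟨hed.1, Finset.sdiff_disjoint⟩
        · rw [Function.update_of_ne (hne m hm)]
          exact hE m hm
      · intro m hm m' hm' hmm
        rcases Finset.mem_insert.1 hm with rfl | hmA <;>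
          rcases Finset.mem_insert.1 hm' with rfl | hmA'
        · exact absurd rfl hmm
        · rw [Function.update_self, Function.update_of_ne (hne m' hmA')]
          exact heU m' hmA'
        · rw [Function.update_self, Function.update_of_ne (hne m hmA)]
          exact (heU m hmA).symm
        · rw [Function.update_of_ne (hne m hmA), Function.update_of_ne (hne m' hmA')]
          exact hdisj m hmA m' hmA' hmm
  obtain ⟨E, hE, hdisj⟩ := greedy Finset.univ
  have hcard : ∀ m : F.MaximalEdge, (E m \ m.1.map φ).card = k - m.1.card := fun m => by
    obtain ⟨h1, h2, -⟩ := hE m (Finset.mem_univ m)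
    rw [Finset.card_sdiff_of_subset h2, G.card_eq _ h1, Finset.card_map]
  let g : ∀ m : F.MaximalEdge, Fin (k - m.1.card) ≃ {w // w ∈ E m \ m.1.map φ} :=
    fun m => ((E m \ m.1.map φ).equivFinOfCardEq (hcard m)).symm
  have hg : ∀ m j, ((g m j : W)) ∉ Finset.univ.map φ := fun m j hj =>
    Finset.disjoint_left.1 (hE m (Finset.mem_univ m)).2.2 (g m j).2 hj
  let f : F.ExtensionVertex → W := Sum.elim φ fun p => (g p.1 p.2 : W)
  have hf : Function.Injective f := by
    refine φ.injective.sumElim ?_ ?_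
    · rintro ⟨m, j⟩ ⟨m', j'⟩ heq
      by_cases hmm : m = m'
      · subst hmm
        have : j = j' := (g m).injective (Subtype.ext heq)
        rw [this]
      · refine absurd (g m j).2 (Finset.disjoint_right.1 (hdisj m (Finset.mem_univ _) m'
          (Finset.mem_univ _) hmm) ?_)
        change (g m j : W) = g m' j' at heq
        rw [heq]
        exact (g m' j').2
    · rintro v ⟨m, j⟩ heq
      refine hg m j ?_
      rw [← heq]
      simp
  refine ⟨⟨f, hf⟩, fun e he => ?_⟩
  obtain ⟨m, -, rfl⟩ := Finset.mem_image.1 he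
  obtain ⟨h1, h2, -⟩ := hE m (Finset.mem_univ m)
  convert h1 using 1
  ext w
  simp only [extendedEdge, Finset.mem_map, Finset.mem_disjSum, Finset.mem_univ, true_and,
    Function.Embedding.sigmaMk_apply, Function.Embedding.coeFn_mk]
  constructor
  · rintro ⟨-, ⟨v, hv, rfl⟩ | ⟨-, ⟨j, rfl⟩, rfl⟩, rfl⟩
    · exact h2 (Finset.mem_map_of_mem φ hv)
    · exact (Finset.mem_sdiff.1 (g m j).2).1
  · intro hw
    by_cases hwm : w ∈ m.1.map φ
    · obtain ⟨v, hv, rfl⟩ := Finset.mem_map.1 hwm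
      exact ⟨Sum.inl v, Or.inl ⟨v, hv, rfl⟩, rfl⟩
    · refine ⟨Sum.inr ⟨m, (g m).symm ⟨w, Finset.mem_sdiff.2 ⟨hw, hwm⟩⟩⟩,
        Or.inr ⟨_, ⟨_, rfl⟩, rfl⟩, ?_⟩
      simp [f]

theorem extendedEdge_mem_extension [Fintype V] (F : PartialKGraph k V) (m : F.MaximalEdge) :
    F.extendedEdge m ∈ F.extension.edges := by
  classical
  exact Finset.mem_image_of_mem _ (Finset.mem_univ m)

/-- A maximal partial edge of the partial `k`-graph generated by the first `k` vertices and the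
pairs is one of these sets. -/
theorem maximal_cliqueWithEdge (hk : 2 ≤ k) (hr : k ≤ r)
    {m : Finset (Fin (r + 1))} (hm : Maximal (· ∈ (cliqueWithEdge k r hk).faces) m) :
    m = (Finset.univ.filter fun i : Fin (r + 1) => (i : ℕ) < k) ∨ m.card = 2 := by
  have hnt : Nontrivial (Fin (r + 1)) := Fin.nontrivial_iff_two_le.2 (by omega)
  have hgen : ∀ s ∈ insert (Finset.univ.filter fun i : Fin (r + 1) => (i : ℕ) < k)
      {e : Finset (Fin (r + 1)) | e.card = 2}, m ⊆ s → m = s := by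
    intro s hs hms
    exact hms.antisymm (hm.2 ⟨hm.1.1.mono hms, Or.inr ⟨s, hs, subset_rfl⟩⟩ hms)
  obtain ⟨-, ⟨v, rfl⟩ | ⟨s, hs, hms⟩⟩ := hm.1
  -- A singleton lies in a pair, so this case is vacuous in substance.
  · obtain ⟨w, hw⟩ := exists_ne v
    have := hgen {v, w} (Or.inr (Finset.card_pair hw.symm)) (by simp)
    right
    rw [this]
    exact Finset.card_pair hw.symm
  · rw [hgen s hs hms]
    exact hs

/-- A pair of vertices lies in a maximal partial edge. -/
theorem exists_maximal_cliqueWithEdge (hk : 2 ≤ k) {i j : Fin (r + 1)} (hij : i ≠ j) :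
    ∃ m : (cliqueWithEdge k r hk).MaximalEdge, i ∈ m.1 ∧ j ∈ m.1 := by
  have hface : ({i, j} : Finset (Fin (r + 1))) ∈ (cliqueWithEdge k r hk).faces :=
    ⟨by simp, Or.inr ⟨{i, j}, Or.inr (Finset.card_pair hij), subset_rfl⟩⟩
  obtain ⟨m, hle, hm⟩ := (Set.toFinite (cliqueWithEdge k r hk).faces).exists_le_maximal hface
  exact ⟨⟨m, hm⟩, hle (by simp), hle (by simp)⟩

/-- The extension of the partial `k`-graph is not contained in an `r`-partite `k`-graph. -/
theorem not_contains_of_coloring (hk : 2 ≤ k) (G : KGraph k W) (c : W → Fin r)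
    (hc : ∀ e ∈ G.edges, Set.InjOn c e) : ¬ G.Contains (cliqueWithEdge k r hk).extension := by
  classical
  rintro ⟨f, hf⟩
  obtain ⟨i, j, hij, hcij⟩ := Fintype.exists_ne_map_eq_of_card_lt
    (fun i : Fin (r + 1) => c (f (Sum.inl i))) (by simp)
  obtain ⟨m, hi, hj⟩ := exists_maximal_cliqueWithEdge hk hij
  have hmem : ∀ i ∈ m.1, f (Sum.inl i) ∈
      ((cliqueWithEdge k r hk).extendedEdge m).map f := fun i hi =>
    Finset.mem_map_of_mem f (by simpa [extendedEdge] using hi)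
  have := hc _ (hf _ (extendedEdge_mem_extension _ m)) (hmem i hi) (hmem j hj) hcij
  exact hij (Sum.inl_injective (f.injective this))

/-- A `k`-graph on `n` vertices without the extension has at most `L n ^ k + O (n ^ (k - 1))`
edges, where `L` is the Lagrangian of the complete `k`-graph on `r` vertices. -/
theorem exists_card_edges_le (hk : 2 ≤ k) (hr : k ≤ r) : ∃ C : ℕ, ∀ (n : ℕ) (G : KGraph k (Fin n)),
    ¬ G.Contains (cliqueWithEdge k r hk).extension →
      (G.edges.card : ℝ) ≤ (KGraph.complete k r).lagrangian * (n : ℝ) ^ k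
        + C * (n : ℝ) ^ (k - 1) := by
  set s := Fintype.card (Fin (r + 1)) + Nat.card (cliqueWithEdge k r hk).MaximalEdge * k with hs
  refine ⟨s + 1, fun n G hG => ?_⟩
  obtain ⟨G', hsub, hcard, hrob⟩ := G.exists_robust_subgraph hk s
  have hG' : ¬ G'.Contains (cliqueWithEdge k r hk).extension := fun ⟨f, hf⟩ =>
    hG ⟨f, fun e he => hsub (hf e he)⟩
  have hLnonneg : 0 ≤ (KGraph.complete k r).lagrangian := by
    have : Nonempty (Fin r) := ⟨⟨0, by omega⟩⟩
    obtain ⟨z, hz, hzl⟩ := KGraph.exists_weight_eq_lagrangian (KGraph.complete k r)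
    exact hzl ▸ KGraph.weight_nonneg _ hz.1
  have hle := G'.card_edges_le_of_weight_le _ hLnonneg (by omega)
    (G'.weight_le_lagrangian_complete (by omega) hr fun T hT hpair e he heT => hG' ?_)
  · rw [Fintype.card_fin] at hle hcard
    have : (G.edges.card : ℝ) ≤ G'.edges.card + (s + 1 : ℕ) * (n : ℝ) ^ (k - 1) := by
      exact_mod_cast hcard
    linarith
  · have hfirst : (Finset.univ.filter fun i : Fin (r + 1) => (i : ℕ) < k).card = k := by
      rw [Fin.card_filter_val_lt]
      omega
    have hdiff : (T \ e).card =
        (Finset.univ.filter fun i : Fin (r + 1) => ¬ (i : ℕ) < k).card := by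
      have h1 := Finset.card_filter_add_card_filter_not (s := Finset.univ)
        (fun i : Fin (r + 1) => (i : ℕ) < k)
      rw [Finset.card_sdiff_of_subset heT, G'.card_eq e he, hT]
      rw [hfirst, Finset.card_univ, Fintype.card_fin] at h1
      omega
    -- The first `k` vertices go onto `e` and the others onto `T \ e`.
    obtain ⟨φ, hφ, hφT⟩ : ∃ φ : Fin (r + 1) ↪ Fin n,
        (Finset.univ.filter fun i : Fin (r + 1) => (i : ℕ) < k).map φ = e ∧ ∀ i, φ i ∈ T := by
      let a := Finset.equivOfCardEq (hfirst.trans (G'.card_eq e he).symm)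
      let b := Finset.equivOfCardEq hdiff.symm
      let φ : Fin (r + 1) → Fin n := fun i =>
        if h : (i : ℕ) < k then a ⟨i, by simpa using h⟩ else b ⟨i, by simpa using h⟩
      have h1 : ∀ i : Fin (r + 1), ∀ h : (i : ℕ) < k, φ i = a ⟨i, by simpa using h⟩ :=
        fun i h => dif_pos h
      have h2 : ∀ i : Fin (r + 1), ∀ h : ¬ (i : ℕ) < k, φ i = b ⟨i, by simpa using h⟩ :=
        fun i h => dif_neg h
      have h1e : ∀ i : Fin (r + 1), (i : ℕ) < k → φ i ∈ e := fun i h => by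
        rw [h1 i h]
        exact (a _).2
      have h2e : ∀ i : Fin (r + 1), ¬ (i : ℕ) < k → φ i ∈ T \ e := fun i h => by
        rw [h2 i h]
        exact (b _).2
      have hinj : Function.Injective φ := by
        intro i j hij
        by_cases hi : (i : ℕ) < k <;> by_cases hj : (j : ℕ) < k
        · rw [h1 i hi, h1 j hj] at hij
          simpa using a.injective (Subtype.ext hij)
        · exact absurd (hij ▸ h1e i hi) (Finset.mem_sdiff.1 (h2e j hj)).2
        · exact absurd (hij ▸ h1e j hj) (Finset.mem_sdiff.1 (h2e i hi)).2
        · rw [h2 i hi, h2 j hj] at hij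
          simpa using b.injective (Subtype.ext hij)
      refine ⟨⟨φ, hinj⟩, Finset.eq_of_subset_of_card_le ?_ ?_, fun i => ?_⟩
      · intro w hw
        obtain ⟨i, hi, rfl⟩ := Finset.mem_map.1 hw
        exact h1e i (Finset.mem_filter.1 hi).2
      · rw [Finset.card_map, hfirst, G'.card_eq e he]
      · by_cases hi : (i : ℕ) < k
        · exact heT (h1e i hi)
        · exact (Finset.mem_sdiff.1 (h2e i hi)).1
    refine contains_extension_of_robust _ G' φ s hs.ge fun m S hS hmS => ?_
    -- The face `[k]` is realized by `e` with no extra vertices; only pairs need robustness.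
    rcases maximal_cliqueWithEdge hk hr m.2 with hm | hm
    · rw [hm, hφ]
      exact ⟨e, he, subset_rfl, by simp⟩
    · obtain ⟨i, j, hij, hmij⟩ := Finset.card_eq_two.1 hm
      rw [hmij] at hmS ⊢
      rw [Finset.disjoint_left] at hmS
      obtain ⟨e', he', hi, hj, hd⟩ := hrob (φ i) (φ j) (φ.injective.ne hij)
        (hpair _ (hφT i) _ (hφT j) (φ.injective.ne hij)) S hS (hmS (by simp)) (hmS (by simp))
      exact ⟨e', he', by simp [Finset.insert_subset_iff, hi, hj],
        hd.mono_left Finset.sdiff_subset⟩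

end PartialKGraph

/-! ### The partite construction and the limit -/

namespace KGraph

variable {k r : ℕ} {W : Type*}

theorem bddAbove_card_edges (n : ℕ) (H : KGraph k W) :
    BddAbove {m | ∃ G : KGraph k (Fin n), ¬ G.Contains H ∧ G.edges.card = m} := by
  refine ⟨Fintype.card (Finset (Fin n)), ?_⟩
  rintro _ ⟨G, -, rfl⟩
  exact Finset.card_le_univ _

theorem card_edges_le_extremalNumber {n : ℕ} {H : KGraph k W} (G : KGraph k (Fin n))
    (hG : ¬ G.Contains H) : G.edges.card ≤ extremalNumber n H :=
  le_csSup (bddAbove_card_edges n H) ⟨G, hG, rfl⟩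

/-- The complete `r`-partite `k`-graph with prescribed part sizes: it has a proper colouring and
the expected number of edges. -/
theorem exists_partite (a : Fin r → ℕ) (n : ℕ) (ha : ∑ i, a i ≤ n) (hr : 0 < r) :
    ∃ (G : KGraph k (Fin n)) (c : Fin n → Fin r), (∀ e ∈ G.edges, Set.InjOn c e) ∧
      ∑ e ∈ (complete k r).edges, ∏ i ∈ e, a i ≤ G.edges.card := by
  classical
  obtain ⟨f⟩ : Nonempty ((Σ i, Fin (a i)) ↪ Fin n) :=
    Function.Embedding.nonempty_of_card_le (by simpa using ha)
  -- Vertices outside the blocks get a default colour; this can only add edges, and only a lower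
  -- bound on their number is needed.
  let c : Fin n → Fin r := fun v => if h : ∃ p, f p = v then h.choose.1 else ⟨0, hr⟩
  have hc : ∀ p, c (f p) = p.1 := by
    intro p
    have h : ∃ q, f q = f p := ⟨p, rfl⟩
    simp only [c, dif_pos h]
    rw [f.injective h.choose_spec]
  refine ⟨⟨(Finset.univ.powersetCard k).filter fun e => Set.InjOn c e, fun e he =>
    (Finset.mem_powersetCard.1 (Finset.mem_filter.1 he).1).2⟩, c,
    fun e he => (Finset.mem_filter.1 he).2, ?_⟩
  -- The left side counts transversals: an edge `e` with one point in each part indexed by `e`. The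
  -- colours and points of its image recover it.
  have h1 : ∑ e ∈ (complete k r).edges, ∏ i ∈ e, a i =
      ((complete k r).edges.sigma fun e => e.pi fun i => (Finset.univ : Finset (Fin (a i)))).card := by
    simp [Finset.card_sigma, Finset.card_pi]
  rw [h1]
  let F : (Σ e : Finset (Fin r), ∀ i ∈ e, Fin (a i)) → Finset (Fin n) := fun p =>
    p.1.attach.image fun i => f ⟨i.1, p.2 i.1 i.2⟩
  have hcF : ∀ p, ∀ i : Fin r, (∃ v ∈ F p, c v = i) ↔ i ∈ p.1 := by
    intro p i
    simp only [F, Finset.mem_image, Finset.mem_attach, true_and]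
    constructor
    · rintro ⟨_, ⟨j, rfl⟩, rfl⟩
      rw [hc]
      exact j.2
    · intro hi
      exact ⟨_, ⟨⟨i, hi⟩, rfl⟩, hc _⟩
  refine Finset.card_le_card_of_injOn F ?_ ?_
  · rintro ⟨e, g⟩ hp
    obtain ⟨he, -⟩ := Finset.mem_sigma.1 hp
    refine Finset.mem_coe.2 (Finset.mem_filter.2
      ⟨Finset.mem_powersetCard.2 ⟨Finset.subset_univ _, ?_⟩, ?_⟩)
    · rw [Finset.card_image_of_injective, Finset.card_attach]
      · exact (complete k r).card_eq e he
      · intro i j hij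
        exact Subtype.ext (congrArg Sigma.fst (f.injective hij))
    · intro v hv w hw hvw
      obtain ⟨i, -, rfl⟩ := Finset.mem_image.1 (Finset.mem_coe.1 hv)
      obtain ⟨j, -, rfl⟩ := Finset.mem_image.1 (Finset.mem_coe.1 hw)
      rw [hc, hc] at hvw
      rw [Subtype.ext hvw]
  · rintro ⟨e, g⟩ - ⟨e', g'⟩ - heq
    have hee : e = e' := by
      ext i
      rw [← hcF ⟨e, g⟩ i, ← hcF ⟨e', g'⟩ i, heq]
    subst hee
    congr 1
    funext i hi
    have hmem : f ⟨i, g i hi⟩ ∈ F ⟨e, g'⟩ := by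
      rw [← heq]
      exact Finset.mem_image.2 ⟨⟨i, hi⟩, Finset.mem_attach _ _, rfl⟩
    obtain ⟨⟨j, hj⟩, -, hjf⟩ := Finset.mem_image.1 hmem
    have h2 := f.injective hjf
    have hji : j = i := congrArg Sigma.fst h2
    subst hji
    exact (eq_of_heq (Sigma.mk.inj h2).2).symm

theorem tendsto_pow_div_choose (k : ℕ) :
    Tendsto (fun n : ℕ => (n : ℝ) ^ k / (n.choose k : ℝ)) atTop (𝓝 (k.factorial : ℝ)) := by
  have h1 : Asymptotics.IsEquivalent atTop (fun n : ℕ => (n : ℝ) ^ k / (n.choose k : ℝ))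
      fun n : ℕ => (n : ℝ) ^ k / ((n : ℝ) ^ k / k.factorial) :=
    Asymptotics.IsEquivalent.refl.div (isEquivalent_choose k)
  refine (h1.symm.tendsto_nhds (tendsto_const_nhds.congr' ?_))
  filter_upwards [eventually_gt_atTop 0] with n hn
  have hn' : (0 : ℝ) < n := by exact_mod_cast hn
  field_simp

end KGraph

theorem corollary8p2 (k r : ℕ) (hk : 2 ≤ k) (hr : k ≤ r) :
    Tendsto (PartialKGraph.cliqueWithEdge k r hk).extension.extremalRatio atTop
        (𝓝 (PartialKGraph.cliqueWithEdge k r hk).extension.turanDensity) ∧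
      (PartialKGraph.cliqueWithEdge k r hk).extension.turanDensity =
        (KGraph.complete k r).blowupDensity := by
  suffices h : Tendsto (PartialKGraph.cliqueWithEdge k r hk).extension.extremalRatio atTop
      (𝓝 (KGraph.complete k r).blowupDensity) by
    have h' : (PartialKGraph.cliqueWithEdge k r hk).extension.turanDensity =
        (KGraph.complete k r).blowupDensity := h.limUnder_eq
    exact ⟨h'.symm ▸ h, h'⟩
  have : Nonempty (Fin r) := ⟨⟨0, by omega⟩⟩
  set L := (KGraph.complete k r).lagrangian with hL
  have hchoose := KGraph.tendsto_pow_div_choose k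
  obtain ⟨x, hx, hxL⟩ := KGraph.exists_weight_eq_lagrangian (KGraph.complete k r)
  obtain ⟨C, hC⟩ := PartialKGraph.exists_card_edges_le hk hr
  have hlow : Tendsto (fun n : ℕ => (∑ e ∈ (KGraph.complete k r).edges,
      ∏ i ∈ e, ((⌊x i * n⌋₊ : ℝ) / n)) * ((n : ℝ) ^ k / (n.choose k : ℝ))) atTop
      (𝓝 (KGraph.complete k r).blowupDensity) := by
    rw [KGraph.blowupDensity, mul_comm, ← hxL]
    refine Tendsto.mul (tendsto_finsetSum _ fun e _ => tendsto_finsetProd _ fun i _ => ?_) hchoose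
    exact (tendsto_nat_floor_mul_div_atTop (hx.1 i)).comp tendsto_natCast_atTop_atTop
  have hup : Tendsto (fun n : ℕ => (L + C * (n : ℝ)⁻¹) * ((n : ℝ) ^ k / (n.choose k : ℝ))) atTop
      (𝓝 (KGraph.complete k r).blowupDensity) := by
    rw [KGraph.blowupDensity, mul_comm]
    refine Tendsto.mul ?_ hchoose
    simpa using (tendsto_inv_atTop_nhds_zero_nat (𝕜 := ℝ)).const_mul (C : ℝ) |>.const_add L
  refine tendsto_of_tendsto_of_tendsto_of_le_of_le' hlow hup ?_ ?_
  · filter_upwards [eventually_gt_atTop 0] with n hn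
    have hn' : (0 : ℝ) < n := by exact_mod_cast hn
    obtain ⟨G, c, hc, hcard⟩ := KGraph.exists_partite (k := k) (fun i => ⌊x i * n⌋₊) n (by
      have : (∑ i, (⌊x i * n⌋₊ : ℝ)) ≤ n := by
        calc _ ≤ ∑ i, x i * n := Finset.sum_le_sum fun i _ =>
              Nat.floor_le (mul_nonneg (hx.1 i) hn'.le)
          _ = n := by rw [← Finset.sum_mul, hx.2, one_mul]
      exact_mod_cast this) (by omega)
    have h1 := hcard.trans (KGraph.card_edges_le_extremalNumber G
      (PartialKGraph.not_contains_of_coloring hk G c hc))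
    rw [KGraph.extremalRatio, ← mul_div_assoc]
    refine div_le_div_of_nonneg_right ?_ (Nat.cast_nonneg _)
    rw [Finset.sum_mul]
    refine le_trans (le_of_eq ?_) (Nat.cast_le.2 h1)
    push_cast
    refine Finset.sum_congr rfl fun e he => ?_
    rw [Finset.prod_div_distrib, Finset.prod_const, (KGraph.complete k r).card_eq e he,
      div_mul_cancel₀ _ (by positivity)]
  · filter_upwards [eventually_gt_atTop 0] with n hn
    have hn' : (0 : ℝ) < n := by exact_mod_cast hn
    rw [KGraph.extremalRatio, ← mul_div_assoc]
    refine div_le_div_of_nonneg_right ?_ (Nat.cast_nonneg _)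
    have h2 : (L + C * (n : ℝ)⁻¹) * (n : ℝ) ^ k = L * (n : ℝ) ^ k + C * (n : ℝ) ^ (k - 1) := by
      obtain ⟨l, rfl⟩ : ∃ l, k = l + 1 := ⟨k - 1, by omega⟩
      rw [Nat.add_sub_cancel, pow_succ]
      field_simp
    rw [h2]
    have hne : {m | ∃ G : KGraph k (Fin n), ¬ G.Contains
        (PartialKGraph.cliqueWithEdge k r hk).extension ∧ G.edges.card = m}.Nonempty := by
      -- Zero part sizes suffice: any coloured graph shows that the set is nonempty, so the supremum
      -- is attained.
      obtain ⟨G, c, hc, -⟩ := KGraph.exists_partite (k := k) (r := r) 0 n (by simp) (by omega)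
      exact ⟨_, G, PartialKGraph.not_contains_of_coloring hk G c hc, rfl⟩
    obtain ⟨G, hG, hGc⟩ := Nat.sSup_mem hne (KGraph.bddAbove_card_edges n _)
    rw [KGraph.extremalNumber, ← hGc]
    exact hC n G hG
end
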